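/- Let $n \geq 1$ be a natural number and let $\mathbb{C}_n$ be the strict partial order on $\mathbb{Q} \times n$, where $n=\{0,\dots,n-1\}$, given by $\langle q_1, i_1\rangle < \langle q_2, i_2\rangle \Leftrightarrow q_1 <_{\mathbb{Q}} q_2$. For a strict partial order $\mathbb{X} = \langle X, <\rangle$ let $\mathbb{P}(\mathbb{X})$ be the set of all $A \subseteq X$ such that $\langle A, < \restriction A\rangle$ is isomorphic to $\mathbb{X}$, and order $\mathbb{P}(\mathbb{X}) \cup \{\emptyset\}$ by inclusion. Then: (i) for each linear order $L$ that is complete (it has a least element $0_L$ and a greatest element, and it has no gaps), embeds into $\langle\mathbb{R},<\rangle$, and in which $0_L$ is not isolated in the order topology, there is a maximal chain in $\langle \mathbb{P}(\mathbb{C}_n) \cup \{\emptyset\}, \subset\rangle$ isomorphic to $L$; (ii) the map $A \mapsto A \times n$ is an isomorphism from the poset $\langle \mathbb{P}(\langle\mathbb{Q},<_{\mathbb{Q}}\rangle) \cup \{\emptyset\}, \subset\rangle$ onto $\langle \mathbb{P}(\mathbb{C}_n) \cup \{\emptyset\}, \subset\rangle$. -/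

import Mathlib

open scoped Topology

/-- The set of copies of a structure `⟨X, r⟩` with one binary relation inside itself: the subsets
`A` of `X` such that the substructure `⟨A, r ∩ A²⟩` is isomorphic to `⟨X, r⟩`. -/
def copies {X : Type*} (r : X → X → Prop) : Set (Set X) :=
  {A | Nonempty (r ≃r Subrel r (fun x => x ∈ A))}

/-- The copies of `⟨X, r⟩` together with the empty set. As a subtype of `Set X` it carries the
inclusion order. -/
def copiesOrEmpty {X : Type*} (r : X → X → Prop) : Set (Set X) :=
  copies r ∪ {∅}

/-- The strict order of `ℚ × n`, by the first coordinate. -/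
def cLT (n : ℕ) (a b : ℚ × Fin n) : Prop :=
  a.1 < b.1

/-! In `ℚ × n` the fibres over `ℚ` are the classes of incomparable points. A copy meets a fibre in
all `n` points or in none, so copies are exactly the products `A × n`. This gives (ii) and reduces
(i) to `n = 1`.

For `ℚ`, label the points of a countable order `X` injectively by a countable set of elements of
`L`, and send `y` to the set of points with label below `y`. If labels separate the points of `L`
and every nonempty such set is dense without endpoints, Cantor's theorem makes it a copy of `X ≅ ℚ`.
Completeness of `L` leaves room for a further set only where one point is added with a label `z`. If
`z` has a successor, the larger set is already in the chain; otherwise `z` is placed to the right of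
all smaller labels, so the larger set has a maximum and is no copy
(`exists_isMaxChain_of_labelling`).

The labels are all elements with a successor (jumps) and countably many points of jump-free
intervals. They are placed on the real line by `exists_isMaxChain_of_skeleton`. Since `⊥` is not
isolated, arbitrarily small labels exist and can be spread densely over the negative rationals; how
depends on whether jumps accumulate at `⊥`. -/

/-- A set is dense in itself and has neither a least nor a greatest element. -/
def DenseNoEndpoints {X : Type*} [LinearOrder X] (S : Set X) : Prop :=
  (∀ a ∈ S, ∃ b ∈ S, b < a) ∧ (∀ a ∈ S, ∃ b ∈ S, a < b) ∧
    ∀ a ∈ S, ∀ b ∈ S, a < b → ∃ c ∈ S, a < c ∧ c < b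

/-! ### Cantor's theorem for subsets, and transport of copies along isomorphisms. -/

theorem DenseNoEndpoints.nonempty_orderIso {X : Type*} [LinearOrder X] {S : Set X}
    (h : DenseNoEndpoints S) (hS : S.Nonempty) (hc : S.Countable) {Y : Type*} [LinearOrder Y]
    [Countable Y] [DenselyOrdered Y] [NoMinOrder Y] [NoMaxOrder Y] [Nonempty Y] :
    Nonempty (Y ≃o S) := by
  have : Countable S := hc.to_subtype
  have : Nonempty S := hS.to_subtype
  have : NoMinOrder S := ⟨fun a => by
    obtain ⟨b, hb, hab⟩ := h.1 a a.2
    exact ⟨⟨b, hb⟩, hab⟩⟩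
  have : NoMaxOrder S := ⟨fun a => by
    obtain ⟨b, hb, hab⟩ := h.2.1 a a.2
    exact ⟨⟨b, hb⟩, hab⟩⟩
  have : DenselyOrdered S := ⟨fun a b hab => by
    obtain ⟨c, hc, h1, h2⟩ := h.2.2 a a.2 b b.2 hab
    exact ⟨⟨c, hc⟩, h1, h2⟩⟩
  exact Order.iso_of_countable_dense Y S

theorem DenseNoEndpoints.of_orderIso {X Y : Type*} [LinearOrder X] [LinearOrder Y]
    [DenselyOrdered Y] [NoMinOrder Y] [NoMaxOrder Y] {S : Set X} (e : Y ≃o S) :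
    DenseNoEndpoints S := by
  refine ⟨fun a ha => ?_, fun a ha => ?_, fun a ha b hb hab => ?_⟩
  · obtain ⟨y, hy⟩ := exists_lt (e.symm ⟨a, ha⟩)
    exact ⟨e y, (e y).2, (e.lt_symm_apply.1 hy : e y < ⟨a, ha⟩)⟩
  · obtain ⟨y, hy⟩ := exists_gt (e.symm ⟨a, ha⟩)
    exact ⟨e y, (e y).2, (e.symm_apply_lt.1 hy : (⟨a, ha⟩ : S) < e y)⟩
  · have : e.symm ⟨a, ha⟩ < e.symm ⟨b, hb⟩ := e.symm.lt_iff_lt.2 hab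
    obtain ⟨y, hy, hy'⟩ := exists_between this
    exact ⟨e y, (e y).2, (e.symm_apply_lt.1 hy : (⟨a, ha⟩ : S) < e y),
      (e.lt_symm_apply.1 hy' : e y < ⟨b, hb⟩)⟩

theorem mem_copies_lt_iff {X : Type*} [LinearOrder X] {S : Set X} :
    S ∈ copies (fun a b : X => a < b) ↔ Nonempty (X ≃o S) :=
  ⟨fun ⟨e⟩ => ⟨OrderIso.ofRelIsoLT e⟩, fun ⟨e⟩ => ⟨e.toRelIsoLT⟩⟩

theorem image_mem_copies {X Y : Type*} {r : X → X → Prop} {s : Y → Y → Prop} (e : r ≃r s)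
    {A : Set X} (hA : A ∈ copies r) : e '' A ∈ copies s := by
  obtain ⟨g⟩ := hA
  refine ⟨e.symm.trans (g.trans ⟨e.toEquiv.image A, ?_⟩)⟩
  intro a b
  exact e.map_rel_iff

theorem image_mem_copiesOrEmpty {X Y : Type*} {r : X → X → Prop} {s : Y → Y → Prop} (e : r ≃r s)
    {A : Set X} (hA : A ∈ copiesOrEmpty r) : e '' A ∈ copiesOrEmpty s := by
  rcases hA with hA | hA
  · exact Or.inl (image_mem_copies e hA)
  · right
    rw [Set.mem_singleton_iff] at hA ⊢
    simp [hA]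

/-- Isomorphic structures have isomorphic posets of copies. -/
def copiesOrEmptyCongr {X Y : Type*} {r : X → X → Prop} {s : Y → Y → Prop} (e : r ≃r s) :
    copiesOrEmpty r ≃o copiesOrEmpty s where
  toFun A := ⟨e '' A, image_mem_copiesOrEmpty e A.2⟩
  invFun B := ⟨e.symm '' B, image_mem_copiesOrEmpty e.symm B.2⟩
  left_inv A := Subtype.ext <| by
    change e.symm '' (e '' A) = A
    rw [Set.image_image]
    simp
  right_inv B := Subtype.ext <| by
    change e '' (e.symm '' B) = B
    rw [Set.image_image]
    simp
  map_rel_iff' {A B} := by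
    change e '' A ⊆ e '' B ↔ (A : Set X) ⊆ B
    exact Set.image_subset_image_iff e.injective

theorem exists_isMaxChain_of_orderIso {L P Q : Type*} [LE L] [PartialOrder P] [PartialOrder Q]
    (e : P ≃o Q) {C : Set P} (hC : IsMaxChain (· ≤ ·) C) (i : L ≃o C) :
    ∃ D : Set Q, IsMaxChain (· ≤ ·) D ∧ Nonempty (L ≃o D) :=
  ⟨e '' C, hC.image e, ⟨i.trans ⟨e.toEquiv.image C, e.le_iff_le⟩⟩⟩

/-! ### Copies of `ℚ × n` are products. -/

section ProductCopies

theorem prod_univ_mem_copiesOrEmpty (n : ℕ) {A : Set ℚ}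
    (hA : A ∈ copiesOrEmpty (fun p q : ℚ => p < q)) :
    A ×ˢ (Set.univ : Set (Fin n)) ∈ copiesOrEmpty (cLT n) := by
  rcases hA with ⟨⟨e⟩⟩ | hA
  · left
    refine ⟨⟨⟨fun x => ⟨(e x.1, x.2), (e x.1).2, trivial⟩,
      fun y => (e.symm ⟨y.1.1, y.2.1⟩, y.1.2), fun x => ?_, fun y => ?_⟩, ?_⟩⟩
    · simp
    · simp
    · intro a b
      exact e.map_rel_iff
  · right
    rw [Set.mem_singleton_iff] at hA ⊢
    simp [hA]

/-- Equality of first coordinates is incomparability, so an isomorphism maps each fibre injectively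
into a fibre. Fibres have the same finite size, hence the map between them is onto. -/
theorem exists_eq_prod_univ {n : ℕ} (hn : 1 ≤ n) {B : Set (ℚ × Fin n)}
    (hB : B ∈ copiesOrEmpty (cLT n)) :
    ∃ A ∈ copiesOrEmpty (fun p q : ℚ => p < q), A ×ˢ (Set.univ : Set (Fin n)) = B := by
  rcases hB with ⟨⟨e⟩⟩ | hB
  · have hlt : ∀ a b, (e a).1.1 < (e b).1.1 ↔ a.1 < b.1 := fun a b => e.map_rel_iff
    have heq : ∀ a b, a.1 = b.1 → (e a).1.1 = (e b).1.1 := fun a b hab => by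
      refine le_antisymm (not_lt.1 fun h => ?_) (not_lt.1 fun h => ?_)
      · exact absurd ((hlt _ _).1 h) (by simp [hab])
      · exact absurd ((hlt _ _).1 h) (by simp [hab])
    have hfull : ∀ x ∈ B, ∀ j, (x.1, j) ∈ B := by
      intro x hx j
      obtain ⟨⟨q, i⟩, hqi⟩ := e.surjective ⟨x, hx⟩
      have hfst : ∀ k, (e (q, k)).1.1 = x.1 := fun k => by
        rw [heq (q, k) (q, i) rfl, hqi]
      have hinj : Function.Injective fun k => (e (q, k)).1.2 := by
        intro k l hkl
        have : e (q, k) = e (q, l) :=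
          Subtype.ext (Prod.ext ((hfst k).trans (hfst l).symm) hkl)
        exact (Prod.mk.inj (e.injective this)).2
      obtain ⟨k, hk⟩ := (Finite.injective_iff_surjective.1 hinj) j
      have : (x.1, j) = (e (q, k)).1 := Prod.ext (hfst k).symm hk.symm
      rw [this]
      exact (e (q, k)).2
    refine ⟨Prod.fst '' B, Or.inl ?_, ?_⟩
    · let z : Fin n := ⟨0, hn⟩
      let g : ℚ → (Prod.fst '' B : Set ℚ) := fun q =>
        ⟨(e (q, z)).1.1, _, (e (q, z)).2, rfl⟩
      have hg : StrictMono g := fun a b hab => (hlt (a, z) (b, z)).2 hab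
      have hs : Function.Surjective g := by
        rintro ⟨_, x, hx, rfl⟩
        obtain ⟨⟨q, i⟩, hqi⟩ := e.surjective ⟨x, hx⟩
        refine ⟨q, Subtype.ext ?_⟩
        change (e (q, z)).1.1 = x.1
        rw [heq (q, z) (q, i) rfl, hqi]
      exact mem_copies_lt_iff.2 ⟨hg.orderIsoOfSurjective g hs⟩
    · ext ⟨q, j⟩
      constructor
      · rintro ⟨⟨x, hx, rfl⟩, -⟩
        exact hfull x hx j
      · intro h
        exact ⟨⟨_, h, rfl⟩, trivial⟩
  · refine ⟨∅, Or.inr rfl, ?_⟩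
    rw [Set.mem_singleton_iff.1 hB]
    simp

theorem exists_orderIso_prod_univ {n : ℕ} (hn : 1 ≤ n) :
    ∃ e : copiesOrEmpty (fun p q : ℚ => p < q) ≃o copiesOrEmpty (cLT n),
      ∀ A, (e A : Set (ℚ × Fin n)) = (A : Set ℚ) ×ˢ (Set.univ : Set (Fin n)) := by
  let f : copiesOrEmpty (fun p q : ℚ => p < q) ↪o copiesOrEmpty (cLT n) :=
    OrderEmbedding.ofMapLEIff
      (fun A => ⟨(A : Set ℚ) ×ˢ Set.univ, prod_univ_mem_copiesOrEmpty n A.2⟩) (by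
        intro A B
        change (A : Set ℚ) ×ˢ (Set.univ : Set (Fin n)) ⊆ (B : Set ℚ) ×ˢ Set.univ ↔ (A : Set ℚ) ⊆ B
        constructor
        · intro h q hq
          exact (h (⟨hq, trivial⟩ : (q, (⟨0, hn⟩ : Fin n)) ∈ (A : Set ℚ) ×ˢ Set.univ)).1
        · intro h
          exact Set.prod_mono h subset_rfl)
  refine ⟨RelIso.ofSurjective f fun B => ?_, fun A => rfl⟩
  obtain ⟨A, hA, hAB⟩ := exists_eq_prod_univ hn B.2
  exact ⟨⟨A, hA⟩, Subtype.ext hAB⟩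

end ProductCopies

/-! ### From a labelling to a maximal chain. -/

section Chain

variable {L : Type*} [CompleteLinearOrder L]

/-- If the elements of a countable linear order `X` are labelled injectively by elements of `L` so
that the initial segments of labels are copies of `ℚ`, and those closed initial segments that are
not of the form `{x | f x < z}` are not, then the sets `{x | f x < y}` form a maximal chain. -/
theorem exists_isMaxChain_of_labelling {X : Type*} [LinearOrder X] [Countable X] {f : X → L}
    (hf : Function.Injective f) (hnb : (⊥ : L) < ⊤)
    (hsep : ∀ x y, x < y → ∃ d, x ≤ f d ∧ f d < y)
    (hdense : ∀ y, ⊥ < y → DenseNoEndpoints {d | f d < y})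
    (hclosed : ∀ d, (¬ ∃ y, f d ⋖ y) → ¬ DenseNoEndpoints {d' | f d' ≤ f d})
    (htop : ∀ d, f d < ⊤) :
    ∃ C : Set (copiesOrEmpty (fun p q : ℚ => p < q)), IsMaxChain (· ≤ ·) C ∧ Nonempty (L ≃o C) := by
  have hne : ∀ y, ⊥ < y → {d | f d < y}.Nonempty := fun y hy =>
    let ⟨d, _, hd⟩ := hsep ⊥ y hy
    ⟨d, hd⟩
  have hiso : ∀ y, ⊥ < y → Nonempty (ℚ ≃o {d | f d < y}) := fun y hy =>
    (hdense y hy).nonempty_orderIso (hne y hy) (Set.to_countable _)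
  have huniv : {d | f d < ⊤} = Set.univ := Set.eq_univ_of_forall htop
  obtain ⟨g⟩ : Nonempty (ℚ ≃o X) := by
    obtain ⟨g⟩ := hiso ⊤ hnb
    rw [huniv] at g
    exact ⟨g.trans OrderIso.Set.univ⟩
  suffices h : ∃ C : Set (copiesOrEmpty (fun p q : X => p < q)),
      IsMaxChain (· ≤ ·) C ∧ Nonempty (L ≃o C) by
    obtain ⟨C, hC, ⟨i⟩⟩ := h
    let e := copiesOrEmptyCongr (r := fun p q : X => p < q) (s := fun p q : ℚ => p < q)
      g.symm.toRelIsoLT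
    exact exists_isMaxChain_of_orderIso e hC i
  have hmem : ∀ y, {d | f d < y} ∈ copiesOrEmpty (fun p q : X => p < q) := by
    intro y
    rcases eq_bot_or_bot_lt y with rfl | hy
    · right
      simp
    · left
      obtain ⟨i⟩ := hiso y hy
      exact mem_copies_lt_iff.2 ⟨g.symm.trans i⟩
  let Φ : L → copiesOrEmpty (fun p q : X => p < q) := fun y => ⟨{d | f d < y}, hmem y⟩
  have hΦ : StrictMono Φ := by
    intro x y hxy
    refine lt_of_le_of_ne (fun d (hd : f d < x) => hd.trans hxy) fun h => ?_
    obtain ⟨d, h1, h2⟩ := hsep x y hxy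
    have : d ∈ (Φ x : Set X) := h ▸ (h2 : d ∈ (Φ y : Set X))
    exact absurd (this : f d < x) h1.not_gt
  refine ⟨Set.range Φ, ⟨hΦ.monotone.isChain_range, fun C' hC' hsub => ?_⟩, ⟨hΦ.orderIso Φ⟩⟩
  refine hsub.antisymm fun B hB => ?_
  rcases B.2 with hBc | hBe
  swap
  · refine ⟨⊥, Subtype.ext ?_⟩
    rw [Set.mem_singleton_iff.1 hBe]
    simp [Φ]
  obtain ⟨b⟩ := mem_copies_lt_iff.1 hBc
  have hBd : DenseNoEndpoints (B : Set X) := DenseNoEndpoints.of_orderIso (g.trans b)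
  have hcomp : ∀ y, Φ y ≤ B ∨ B ≤ Φ y := fun y => hC'.total (hsub ⟨y, rfl⟩) hB
  -- `B` is trapped between the points with label `< z` and those with label `≤ z`; since `f` is
  -- injective, these differ by at most one point.
  let z := sSup {y | Φ y ≤ B}
  have hz1 : Φ z ≤ B := by
    intro d hd
    obtain ⟨y, hy, hdy⟩ := lt_sSup_iff.1 (hd : f d < z)
    exact hy hdy
  have hz2 : ∀ d ∈ (B : Set X), f d ≤ z := by
    intro d hd
    by_contra! h
    rcases hcomp (f d) with h' | h'
    · exact absurd (le_sSup (a := f d) h' : f d ≤ z) h.not_ge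
    · exact lt_irrefl _ (h' hd : f d < f d)
  by_cases hBz : B ≤ Φ z
  · exact ⟨z, le_antisymm hz1 hBz⟩
  obtain ⟨d, hd, hdz⟩ := Set.not_subset.1 hBz
  have hdz : f d = z := le_antisymm (hz2 d hd) (not_lt.1 hdz)
  have hBeq : (B : Set X) = {d' | f d' ≤ f d} := by
    refine Set.Subset.antisymm (fun d' hd' => (hz2 d' hd').trans hdz.ge) fun d' hd' => ?_
    rcases (show f d' ≤ f d from hd').lt_or_eq with h | h
    · exact hz1 (h.trans_eq hdz)
    · rwa [hf h]
  -- When `f d` has a successor `y`, labels `≤ f d` are the labels `< y`, so `B` is in the chain;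
  -- otherwise `hclosed` says `B` is not a copy.
  by_cases hcov : ∃ y, f d ⋖ y
  · obtain ⟨y, hy⟩ := hcov
    refine ⟨y, Subtype.ext ?_⟩
    rw [hBeq]
    ext d'
    exact ⟨fun h : f d' < y => not_lt.1 fun h' => hy.2 h' h, fun h : f d' ≤ f d => h.trans_lt hy.1⟩
  · exact absurd (hBeq ▸ hBd) (hclosed d hcov)

/-- The version of `exists_isMaxChain_of_labelling` in which `X` is the set of positions on the real
line of the elements of a subset `E` of `L`. -/
theorem exists_isMaxChain_of_position {E : Set L} (hE : E.Countable) {pos : L → ℝ}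
    (hpos : Set.InjOn pos E) (hnb : (⊥ : L) < ⊤)
    (hsep : ∀ x y, x < y → ∃ e ∈ E, x ≤ e ∧ e < y)
    (hdense : ∀ y, ⊥ < y → DenseNoEndpoints (pos '' (E ∩ Set.Iio y)))
    (hclosed : ∀ z ∈ E, (¬ ∃ y, z ⋖ y) → ¬ DenseNoEndpoints (pos '' (E ∩ Set.Iic z)))
    (htop : ⊤ ∉ E) :
    ∃ C : Set (copiesOrEmpty (fun p q : ℚ => p < q)), IsMaxChain (· ≤ ·) C ∧ Nonempty (L ≃o C) := by
  have : Countable (pos '' E) := (hE.image pos).to_subtype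
  choose f hfE hfpos using fun x : (pos '' E : Set ℝ) => x.2
  have hfp : ∀ e (he : e ∈ E), f ⟨pos e, e, he, rfl⟩ = e := fun e he =>
    hpos (hfE _) he (hfpos _)
  have himg : ∀ T : Set L, DenseNoEndpoints {d | f d ∈ T} ↔ DenseNoEndpoints (pos '' (E ∩ T)) := by
    intro T
    have hT : pos '' (E ∩ T) = Subtype.val '' {d | f d ∈ T} := by
      ext r
      constructor
      · rintro ⟨e, ⟨he, heT⟩, rfl⟩
        exact ⟨⟨pos e, e, he, rfl⟩, by simpa [hfp e he] using heT, rfl⟩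
      · rintro ⟨d, hd, rfl⟩
        exact ⟨f d, ⟨hfE d, hd⟩, hfpos d⟩
    rw [hT]
    simp only [DenseNoEndpoints, Set.forall_mem_image, Set.exists_mem_image, Subtype.coe_lt_coe]
  refine exists_isMaxChain_of_labelling (f := f) ?_ hnb ?_ ?_ ?_ ?_
  · intro a b hab
    rw [Subtype.ext_iff, ← hfpos a, ← hfpos b, hab]
  · intro x y hxy
    obtain ⟨e, he, h⟩ := hsep x y hxy
    exact ⟨⟨pos e, e, he, rfl⟩, by rwa [hfp e he]⟩
  · intro y hy
    exact (himg (Set.Iio y)).2 (hdense y hy)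
  · intro d hd h
    exact hclosed _ (hfE d) hd ((himg (Set.Iic (f d))).1 h)
  · intro d
    exact lt_top_iff_ne_top.2 fun h => htop (h ▸ hfE d)

end Chain

/-! ### Jumps, jump-free intervals, and the placement of labels on the real line. -/

section Positions

/-- The elements with an immediate successor. -/
def jumps (L : Type*) [LinearOrder L] : Set L := {x | ∃ y, x ⋖ y}

/-- Distinct jumps span disjoint open intervals under `φ`, and each contains a rational. -/
theorem countable_jumps {L : Type*} [LinearOrder L] (φ : L ↪o ℝ) : (jumps L).Countable := by
  choose! s hs using fun x (hx : x ∈ jumps L) => hx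
  choose! q hq using fun x (hx : x ∈ jumps L) => exists_rat_btwn (φ.lt_iff_lt.2 (hs x hx).1)
  refine (Set.countable_univ (α := ℚ)).mono (Set.subset_univ (q '' jumps L)) |>
    Set.countable_of_injective_of_countable_image ?_
  have key : ∀ a ∈ jumps L, ∀ b ∈ jumps L, a < b → q a < q b := by
    intro a ha b hb hab
    have : s a ≤ b := not_lt.1 fun h => (hs a ha).2 hab h
    exact_mod_cast (hq a ha).2.trans_le ((φ.le_iff_le.2 this).trans (hq b hb).1.le)
  intro a ha b hb hab
  rcases lt_trichotomy a b with h | h | h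
  · exact absurd hab (key a ha b hb h).ne
  · exact h
  · exact absurd hab (key b hb a ha h).ne'

theorem exists_between_of_jumpFree {L : Type*} [LinearOrder L] {a b : L}
    (hab : a < b) (ha : a ∉ jumps L) : ∃ c, a < c ∧ c < b := by
  by_contra! h
  exact ha ⟨b, hab, fun c h1 h2 => (h c h1).not_gt h2⟩

/-- A countable set of points inside jump-free intervals that meets each jump-free interval. -/
theorem exists_countable_jumpFree {L : Type*} [LinearOrder L] (φ : L ↪o ℝ) :
    ∃ F : Set L, F.Countable ∧
      (∀ z ∈ F, ∃ x y, x < z ∧ z < y ∧ ∀ a, x ≤ a → a < y → a ∉ jumps L) ∧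
      ∀ x y, x < y → (∀ a, x ≤ a → a < y → a ∉ jumps L) → ∃ z ∈ F, x < z ∧ z < y := by
  let M : Set L := {z | ∃ x y, x < z ∧ z < y ∧ ∀ a, x ≤ a → a < y → a ∉ jumps L}
  -- One point of `M` is chosen for each rational interval that meets the image of `M`; such
  -- intervals fit inside the image of any jump-free interval.
  let I : Set (ℚ × ℚ) := {p | ∃ z ∈ M, (p.1 : ℝ) < φ z ∧ φ z < p.2}
  choose c hcM hc using fun p : I => p.2
  refine ⟨Set.range c, Set.countable_range c, ?_, ?_⟩
  · rintro _ ⟨p, rfl⟩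
    exact hcM p
  · intro x y hxy hfree
    obtain ⟨z₁, h1, h1y⟩ := exists_between_of_jumpFree hxy (hfree x le_rfl hxy)
    obtain ⟨z₂, h2, h2y⟩ := exists_between_of_jumpFree h1y (hfree z₁ h1.le h1y)
    obtain ⟨p, hp1, hp2⟩ := exists_rat_btwn (φ.lt_iff_lt.2 h2)
    obtain ⟨q, hq1, hq2⟩ := exists_rat_btwn (φ.lt_iff_lt.2 h2y)
    let i : I := ⟨(p, q), z₂, ⟨x, y, h1.trans h2, h2y, hfree⟩, hp2, hq1⟩
    refine ⟨c i, ⟨i, rfl⟩, h1.trans (φ.lt_iff_lt.1 (hp1.trans (hc i).1)), ?_⟩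
    exact φ.lt_iff_lt.1 ((hc i).2.trans hq2)

variable {L : Type*} [CompleteLinearOrder L]

/-- Given a set `G` of labels placed at negative rationals so that small labels are already placed
densely, all jumps and a countable dense set of jump-free points can be placed. -/
theorem exists_isMaxChain_of_skeleton (φ : L ↪o ℝ) (hnb : (⊥ : L) < ⊤) {F G : Set L}
    (hFc : F.Countable)
    (hF : ∀ z ∈ F, ∃ x y, x < z ∧ z < y ∧ ∀ a, x ≤ a → a < y → a ∉ jumps L)
    (hFd : ∀ x y, x < y → (∀ a, x ≤ a → a < y → a ∉ jumps L) → ∃ z ∈ F, x < z ∧ z < y)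
    (hG : G ⊆ jumps L ∪ F) {p : L → ℚ} (hp : Set.InjOn p G) (hneg : ∀ g ∈ G, p g < 0)
    (hdense : ∀ y, ⊥ < y → (∀ a b : ℝ, a < b → b ≤ 0 → ∃ g ∈ G, g < y ∧ a < p g ∧ (p g : ℝ) < b) ∨
      ((∀ e ∈ jumps L ∪ F, e < y → e ∈ G) ∧ DenseNoEndpoints (p '' (G ∩ Set.Iio y))))
    (hmax : ∀ z ∈ G, z ∉ jumps L → ∀ e ∈ jumps L ∪ F, e ≤ z → e ∈ G ∧ p e ≤ p z) :
    ∃ C : Set (copiesOrEmpty (fun p q : ℚ => p < q)), IsMaxChain (· ≤ ·) C ∧ Nonempty (L ≃o C) := by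
  classical
  have hJc := countable_jumps φ
  obtain ⟨enc, henc⟩ := Set.countable_iff_exists_injOn.1 hJc
  have hFJ : ∀ z ∈ F, z ∉ jumps L := fun z hz => by
    obtain ⟨x, y, h1, h2, h⟩ := hF z hz
    exact h z h1.le h2
  -- Three disjoint ranges: negative rationals for `G`, negative irrationals for the other jumps,
  -- and positive reals, in the order of `L`, for the rest of `F`. Extra negative points do no harm
  -- where `G` is already dense.
  let pos : L → ℝ := fun e =>
    if e ∈ G then (p e : ℝ) else if e ∈ jumps L then -√2 - enc e else φ e - φ ⊥
  have posG : ∀ e ∈ G, pos e = p e := fun e he => if_pos he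
  have posJ : ∀ e, e ∉ G → e ∈ jumps L → pos e = -√2 - enc e := fun e h1 h2 => by
    simp [pos, h1, h2]
  have posF : ∀ e, e ∉ G → e ∉ jumps L → pos e = φ e - φ ⊥ := fun e h1 h2 => by
    simp [pos, h1, h2]
  have negG : ∀ e ∈ G, pos e < 0 := fun e he => by
    rw [posG e he]
    exact_mod_cast hneg e he
  have negJ : ∀ e, e ∉ G → e ∈ jumps L → pos e < 0 := fun e h1 h2 => by
    rw [posJ e h1 h2]
    have : 0 < √2 := by positivity
    have : (0 : ℝ) ≤ enc e := by positivity
    linarith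
  have bot_lt_F : ∀ e ∈ F, ⊥ < e := fun e he => by
    obtain ⟨x, _, h, _⟩ := hF e he
    exact bot_le.trans_lt h
  have posit : ∀ e ∈ F, e ∉ G → 0 < pos e := fun e he h1 => by
    rw [posF e h1 (hFJ e he), sub_pos]
    exact φ.lt_iff_lt.2 (bot_lt_F e he)
  have cases3 : ∀ e ∈ jumps L ∪ F, e ∈ G ∨ (e ∉ G ∧ e ∈ jumps L) ∨ (e ∉ G ∧ e ∈ F) := by
    intro e he
    by_cases h : e ∈ G
    · exact Or.inl h
    · exact Or.inr (he.imp (fun h' => ⟨h, h'⟩) fun h' => ⟨h, h'⟩)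
  have cases2 : ∀ e ∈ jumps L ∪ F, pos e < 0 ∨ (0 < pos e ∧ e ∈ F ∧ e ∉ G) := by
    intro e he
    rcases cases3 e he with h | ⟨h, h'⟩ | ⟨h, h'⟩
    · exact Or.inl (negG e h)
    · exact Or.inl (negJ e h h')
    · exact Or.inr ⟨posit e h' h, h', h⟩
  have posF_lt : ∀ a ∈ F, a ∉ G → ∀ b ∈ F, b ∉ G → (pos a < pos b ↔ a < b) := by
    intro a ha ha' b hb hb'
    rw [posF a ha' (hFJ a ha), posF b hb' (hFJ b hb), sub_lt_sub_iff_right, φ.lt_iff_lt]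
  have rat_ne : ∀ a ∈ G, ∀ b, b ∉ G → b ∈ jumps L → pos a ≠ pos b := by
    intro a ha b hb hb' h
    rw [posG a ha, posJ b hb hb'] at h
    refine irrational_sqrt_two ⟨-(p a) - enc b, ?_⟩
    push_cast
    linarith
  have F_above : ∀ e ∈ F, e ∉ G → ∀ y, e < y → ∃ e' ∈ F, e' ∉ G ∧ e < e' ∧ e' < y := by
    intro e he heG y hy
    obtain ⟨x', y', h1, h2, h⟩ := hF e he
    obtain ⟨z, hz, hz1, hz2⟩ := hFd e (min y y') (lt_min hy h2)
      fun a ha ha' => h a (h1.le.trans ha) (ha'.trans_le (min_le_right _ _))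
    -- By `hmax`, a label of `F` in `G` forces all smaller labels into `G`.
    refine ⟨z, hz, fun hzG => heG ?_, hz1, hz2.trans_le (min_le_left _ _)⟩
    exact (hmax z hzG (hFJ z hz) e (Or.inr he) hz1.le).1
  refine exists_isMaxChain_of_position (E := jumps L ∪ F) (pos := pos) (hJc.union hFc) ?_ hnb
    ?_ ?_ ?_ ?_
  · intro a ha b hb hab
    rcases cases3 a ha with h | ⟨h, h'⟩ | ⟨h, h'⟩ <;> rcases cases3 b hb with k | ⟨k, k'⟩ | ⟨k, k'⟩
    · rw [posG a h, posG b k] at hab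
      exact hp h k (by exact_mod_cast hab)
    · exact absurd hab (rat_ne a h b k k')
    · exact absurd hab ((negG a h).trans (posit b k' k)).ne
    · exact absurd hab.symm (rat_ne b k a h h')
    · rw [posJ a h h', posJ b k k'] at hab
      exact henc h' k' (by exact_mod_cast sub_right_injective hab)
    · exact absurd hab ((negJ a h h').trans (posit b k' k)).ne
    · exact absurd hab ((negG b k).trans (posit a h' h)).ne'
    · exact absurd hab ((negJ b k k').trans (posit a h' h)).ne'
    · rcases lt_trichotomy a b with hlt | heq | hgt
      · exact absurd hab ((posF_lt a h' h b k' k).2 hlt).ne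
      · exact heq
      · exact absurd hab ((posF_lt b k' k a h' h).2 hgt).ne'
  · intro x y hxy
    by_cases h : ∃ j ∈ jumps L, x ≤ j ∧ j < y
    · obtain ⟨j, hj, hj'⟩ := h
      exact ⟨j, Or.inl hj, hj'⟩
    · push Not at h
      obtain ⟨z, hz, h1, h2⟩ := hFd x y hxy fun a h1 h2 h3 => (h a h3 h1).not_gt h2
      exact ⟨z, Or.inr hz, h1.le, h2⟩
  · intro y hy
    rcases hdense y hy with hd | ⟨hall, hd⟩
    · have hd' : ∀ a b : ℝ, a < b → b ≤ 0 →
          ∃ e ∈ (jumps L ∪ F) ∩ Set.Iio y, a < pos e ∧ pos e < b := by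
        intro a b hab hb
        obtain ⟨g, hg, hgy, h⟩ := hd a b hab hb
        exact ⟨g, ⟨hG hg, hgy⟩, by rwa [posG g hg]⟩
      simp only [DenseNoEndpoints, Set.forall_mem_image, Set.exists_mem_image]
      refine ⟨fun a ha => ?_, fun a ha => ?_, fun a ha b hb hab => ?_⟩
      · obtain ⟨e, he, _, h⟩ := hd' (min (pos a) 0 - 1) (min (pos a) 0) (by linarith)
          (min_le_right _ _)
        exact ⟨e, he, h.trans_le (min_le_left _ _)⟩
      · rcases cases2 a ha.1 with h | ⟨_, h, h'⟩
        · obtain ⟨e, he, h1, _⟩ := hd' (pos a) 0 h le_rfl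
          exact ⟨e, he, h1⟩
        · obtain ⟨e, he, heG, h1, h2⟩ := F_above a h h' y ha.2
          exact ⟨e, ⟨Or.inr he, h2⟩, (posF_lt a h h' e he heG).2 h1⟩
      · rcases cases2 a ha.1 with h | ⟨h0, h, h'⟩
        · obtain ⟨e, he, h1, h2⟩ := hd' (pos a) (min (pos b) 0) (lt_min hab h) (min_le_right _ _)
          exact ⟨e, he, h1, h2.trans_le (min_le_left _ _)⟩
        · rcases cases2 b hb.1 with k | ⟨_, k, k'⟩
          · exact absurd k (h0.trans hab).not_gt
          obtain ⟨e, he, heG, h1, h2⟩ := F_above a h h' b ((posF_lt a h h' b k k').1 hab)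
          exact ⟨e, ⟨Or.inr he, h2.trans hb.2⟩, (posF_lt a h h' e he heG).2 h1,
            (posF_lt e he heG b k k').2 h2⟩
    · have hEG : (jumps L ∪ F) ∩ Set.Iio y = G ∩ Set.Iio y :=
        Set.Subset.antisymm (fun e he => ⟨hall e he.1 he.2, he.2⟩) fun e he => ⟨hG he.1, he.2⟩
      have himg : pos '' (G ∩ Set.Iio y) = (fun q : ℚ => (q : ℝ)) '' (p '' (G ∩ Set.Iio y)) := by
        rw [Set.image_image]
        exact Set.image_congr fun e he => posG e he.1
      rw [hEG, himg]
      simpa only [DenseNoEndpoints, Set.forall_mem_image, Set.exists_mem_image, Rat.cast_lt]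
        using hd
  · intro z hz hzJ hcon
    -- The position of `z` is the greatest among those of labels `≤ z`: by `hmax` if `z` is in `G`,
    -- otherwise because it is positive and `F` outside `G` keeps its order.
    obtain ⟨_, ⟨e, ⟨he, hez⟩, rfl⟩, hlt⟩ := hcon.2.1 (pos z) ⟨z, ⟨hz, le_rfl⟩, rfl⟩
    have hzF : z ∈ F := hz.resolve_left hzJ
    refine absurd hlt (not_lt.2 ?_)
    by_cases hzG : z ∈ G
    · obtain ⟨heG, hle⟩ := hmax z hzG hzJ e he hez
      rw [posG e heG, posG z hzG]
      exact_mod_cast hle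
    · rcases cases2 e he with h | ⟨_, h, h'⟩
      · exact (h.trans (posit z hzF hzG)).le
      · exact not_lt.1 fun hc => ((posF_lt z hzF hzG e h h').1 hc).not_ge hez
  · rintro (⟨y, hy⟩ | h)
    · exact not_top_lt hy.1
    · obtain ⟨_, y, _, hy, _⟩ := hF _ h
      exact not_top_lt hy

/-- Here `G` is a sequence of jumps decreasing to `⊥`, matched arbitrarily with the negative
rationals. Only finitely many terms fail to lie below a given `y > ⊥`, so the rationals used below
`y` stay dense. `G` has no jump-free labels, so `hmax` is vacuous. -/
theorem exists_isMaxChain_of_jumps_accumulate (φ : L ↪o ℝ) (hnb : (⊥ : L) < ⊤)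
    (hbot : ⊥ ∉ jumps L) (hacc : ∀ y : L, ⊥ < y → ∃ j ∈ jumps L, j < y) :
    ∃ C : Set (copiesOrEmpty (fun p q : ℚ => p < q)), IsMaxChain (· ≤ ·) C ∧ Nonempty (L ≃o C) := by
  obtain ⟨F, hFc, hF, hFd⟩ := exists_countable_jumpFree φ
  have hpos : ∀ j ∈ jumps L, ⊥ < j := fun j hj =>
    bot_lt_iff_ne_bot.2 fun h => hbot (h ▸ hj)
  have hne : (φ '' jumps L).Nonempty := by
    obtain ⟨j, hj, _⟩ := hacc ⊤ hnb
    exact ⟨_, j, hj, rfl⟩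
  have hbdd : BddBelow (φ '' jumps L) := ⟨φ ⊥, by
    rintro _ ⟨j, _, rfl⟩
    exact φ.le_iff_le.2 bot_le⟩
  have hglb := isGLB_csInf hne hbdd
  have hlt : ∀ j ∈ jumps L, sInf (φ '' jumps L) < φ j := fun j hj => by
    obtain ⟨j', hj', h⟩ := hacc j (hpos j hj)
    exact (hglb.1 ⟨j', hj', rfl⟩).trans_lt (φ.lt_iff_lt.2 h)
  -- Accumulation at `⊥` means that the infimum is not attained, which makes the sequence strictly
  -- decreasing.
  obtain ⟨u, hu, -, hlim, hmem⟩ := hglb.exists_seq_strictAnti_tendsto_of_notMem (by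
    rintro ⟨j, hj, h⟩
    exact (hlt j hj).ne h.symm) hne
  choose e heJ heu using hmem
  have he : StrictAnti e := fun m n hmn => by
    rw [← φ.lt_iff_lt, heu, heu]
    exact hu hmn
  have hey : ∀ y, ⊥ < y → ∃ N, ∀ m, N ≤ m → e m < y := by
    intro y hy
    obtain ⟨j, hj, hjy⟩ := hacc y hy
    obtain ⟨N, hN⟩ := Filter.eventually_atTop.1 (hlim.eventually_lt_const (hlt j hj))
    refine ⟨N, fun m hm => (φ.lt_iff_lt.1 ?_).trans hjy⟩
    rw [heu]
    exact hN m hm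
  have : Infinite (Set.Iio (0 : ℚ)) := Set.infinite_coe_iff.2 (Set.Iio_infinite 0)
  obtain ⟨v⟩ : Nonempty (ℕ ≃ Set.Iio (0 : ℚ)) := nonempty_equiv_of_countable
  let p : L → ℚ := fun x => v (Function.invFun e x)
  have hpe : ∀ n, p (e n) = v n := fun n => by
    simp only [p, Function.leftInverse_invFun he.injective n]
  refine exists_isMaxChain_of_skeleton φ hnb hFc hF hFd (G := Set.range e) (p := p) ?_ ?_ ?_ ?_ ?_
  · rintro _ ⟨n, rfl⟩
    exact Or.inl (heJ n)
  · rintro _ ⟨m, rfl⟩ _ ⟨n, rfl⟩ h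
    rw [hpe, hpe] at h
    rw [v.injective (Subtype.ext h)]
  · rintro _ ⟨n, rfl⟩
    rw [hpe]
    exact (v n).2
  · intro y hy
    left
    intro a b hab hb
    obtain ⟨N, hN⟩ := hey y hy
    obtain ⟨q₁, h1, h1b⟩ := exists_rat_btwn hab
    obtain ⟨q₂, h2, h2b⟩ := exists_rat_btwn h1b
    -- Some rational of the interval avoids the finitely many with index below `N`.
    have hinf : (Set.Ioo q₁ q₂).Infinite := Set.Ioo_infinite (by exact_mod_cast h2)
    obtain ⟨q, hq, hqN⟩ := hinf.exists_notMem_finite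
      ((Set.finite_Iio N).image fun n => (v n : ℚ))
    have hq2 : (q : ℝ) < b := lt_trans (by exact_mod_cast hq.2) h2b
    have hq0 : q < 0 := by exact_mod_cast hq2.trans_le hb
    obtain ⟨n, hn⟩ := v.surjective ⟨q, hq0⟩
    have hnN : N ≤ n := not_lt.1 fun h => hqN ⟨n, h, by simp [hn]⟩
    refine ⟨e n, ⟨n, rfl⟩, hN n hnN, ?_⟩
    rw [hpe, hn]
    exact ⟨h1.trans (by exact_mod_cast hq.1), hq2⟩
  · rintro _ ⟨n, rfl⟩ h
    exact absurd (heJ n) h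

/-- Below `ε` the labels are those of `F`, which are dense without endpoints there; Cantor's theorem
places them in order onto the negative rationals. For `y ≤ ε` nothing else lies below `y`; for `y ≥
ε` all negative rationals are in use. -/
theorem exists_isMaxChain_of_jumpFree_bot (φ : L ↪o ℝ) {ε : L} (hε : ⊥ < ε)
    (hfree : ∀ a : L, a < ε → a ∉ jumps L) :
    ∃ C : Set (copiesOrEmpty (fun p q : ℚ => p < q)), IsMaxChain (· ≤ ·) C ∧ Nonempty (L ≃o C) := by
  classical
  obtain ⟨F, hFc, hF, hFd⟩ := exists_countable_jumpFree φ
  have hFbot : ∀ z ∈ F, ⊥ < z := fun z hz => by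
    obtain ⟨x, _, h, _⟩ := hF z hz
    exact bot_le.trans_lt h
  have hbtw : ∀ x y, x < y → y ≤ ε → ∃ z ∈ F, x < z ∧ z < y := fun x y hxy hy =>
    hFd x y hxy fun a _ ha => hfree a (ha.trans_le hy)
  have hGd : ∀ y, y ≤ ε → DenseNoEndpoints (F ∩ Set.Iio y) := by
    refine fun y hy => ⟨fun a ha => ?_, fun a ha => ?_, fun a ha b hb hab => ?_⟩
    · obtain ⟨z, hz, _, h⟩ := hbtw ⊥ a (hFbot a ha.1) (ha.2.le.trans hy)
      exact ⟨z, ⟨hz, h.trans ha.2⟩, h⟩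
    · obtain ⟨z, hz, h, h'⟩ := hbtw a y ha.2 hy
      exact ⟨z, ⟨hz, h'⟩, h⟩
    · obtain ⟨z, hz, h, h'⟩ := hbtw a b hab (hb.2.le.trans hy)
      exact ⟨z, ⟨hz, h'.trans hb.2⟩, h, h'⟩
  have hGne : (F ∩ Set.Iio ε).Nonempty := by
    obtain ⟨z, hz, _, h⟩ := hbtw ⊥ ε hε le_rfl
    exact ⟨z, hz, h⟩
  obtain ⟨i⟩ := (hGd ε le_rfl).nonempty_orderIso hGne (hFc.mono Set.inter_subset_left)
    (Y := Set.Iio (0 : ℚ))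
  -- The default `0` is never used on `G`.
  let p : L → ℚ := fun x => if h : x ∈ F ∩ Set.Iio ε then i.symm ⟨x, h⟩ else 0
  have hpG : ∀ x (h : x ∈ F ∩ Set.Iio ε), p x = i.symm ⟨x, h⟩ := fun x h => dif_pos h
  have hp_lt : ∀ x ∈ F ∩ Set.Iio ε, ∀ y ∈ F ∩ Set.Iio ε, (p x < p y ↔ x < y) := by
    intro x hx y hy
    rw [hpG x hx, hpG y hy, Subtype.coe_lt_coe, i.symm.lt_iff_lt, Subtype.mk_lt_mk]
  have hin : ∀ e ∈ jumps L ∪ F, e < ε → e ∈ F ∩ Set.Iio ε := fun e he h =>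
    ⟨he.resolve_left (hfree e h), h⟩
  refine exists_isMaxChain_of_skeleton φ (hε.trans_le le_top) hFc hF hFd (G := F ∩ Set.Iio ε)
    (p := p) (fun x hx => Or.inr hx.1) ?_ ?_ ?_ ?_
  · intro x hx y hy h
    rcases lt_trichotomy x y with k | k | k
    · exact absurd h ((hp_lt x hx y hy).2 k).ne
    · exact k
    · exact absurd h ((hp_lt y hy x hx).2 k).ne'
  · intro x hx
    rw [hpG x hx]
    exact (i.symm ⟨x, hx⟩).2
  · intro y _
    rcases le_total y ε with hy | hy
    · right
      refine ⟨fun e he h => hin e he (h.trans_le hy), ?_⟩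
      have hG : F ∩ Set.Iio ε ∩ Set.Iio y = F ∩ Set.Iio y := by
        rw [Set.inter_assoc, Set.Iio_inter_Iio, min_eq_right hy]
      have hsub : ∀ x ∈ F ∩ Set.Iio y, x ∈ F ∩ Set.Iio ε := fun x hx => ⟨hx.1, hx.2.trans_le hy⟩
      rw [hG]
      obtain ⟨d1, d2, d3⟩ := hGd y hy
      simp only [DenseNoEndpoints, Set.forall_mem_image, Set.exists_mem_image]
      refine ⟨fun a ha => ?_, fun a ha => ?_, fun a ha b hb hab => ?_⟩
      · obtain ⟨z, hz, h⟩ := d1 a ha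
        exact ⟨z, hz, (hp_lt z (hsub z hz) a (hsub a ha)).2 h⟩
      · obtain ⟨z, hz, h⟩ := d2 a ha
        exact ⟨z, hz, (hp_lt a (hsub a ha) z (hsub z hz)).2 h⟩
      · obtain ⟨z, hz, h, h'⟩ := d3 a ha b hb ((hp_lt a (hsub a ha) b (hsub b hb)).1 hab)
        exact ⟨z, hz, (hp_lt a (hsub a ha) z (hsub z hz)).2 h,
          (hp_lt z (hsub z hz) b (hsub b hb)).2 h'⟩
    · left
      intro a b hab hb
      obtain ⟨q, h1, h2⟩ := exists_rat_btwn hab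
      have hq0 : q < 0 := by exact_mod_cast h2.trans_le hb
      have hq : p (i ⟨q, hq0⟩) = q := by
        rw [hpG _ (i ⟨q, hq0⟩).2]
        simp
      refine ⟨i ⟨q, hq0⟩, (i ⟨q, hq0⟩).2, (i ⟨q, hq0⟩).2.2.trans_le hy, ?_⟩
      rw [hq]
      exact ⟨h1, h2⟩
  · intro z hz _ e he hez
    have heG := hin e he (hez.trans_lt hz.2)
    exact ⟨heG, not_lt.1 fun h => ((hp_lt z hz e heG).1 h).not_ge hez⟩

end Positions

/-! ### The two cases at `⊥`, and the transfer from `ℚ` to `ℚ × n`. -/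

theorem exists_isMaxChain_copies_rat {L : Type*} [CompleteLinearOrder L] [TopologicalSpace L]
    [OrderTopology L] (φ : L ↪o ℝ) (h : (𝓝[≠] (⊥ : L)).NeBot) :
    ∃ C : Set (copiesOrEmpty (fun p q : ℚ => p < q)), IsMaxChain (· ≤ ·) C ∧ Nonempty (L ≃o C) := by
  have hnb : (⊥ : L) < ⊤ := by
    have : Nontrivial L := by
      obtain ⟨x, hx⟩ := h.nonempty_of_mem self_mem_nhdsWithin
      exact ⟨x, ⊥, hx⟩
    exact bot_lt_top
  -- A successor of `⊥` would isolate it.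
  have hbot : (⊥ : L) ∉ jumps L := by
    rintro ⟨y, hy⟩
    obtain ⟨x, hx, hx'⟩ := h.nonempty_of_mem
      (Filter.inter_mem (mem_nhdsWithin_of_mem_nhds (Iio_mem_nhds hy.1)) self_mem_nhdsWithin)
    exact hy.2 (bot_lt_iff_ne_bot.2 hx') hx
  by_cases hacc : ∀ y : L, ⊥ < y → ∃ j ∈ jumps L, j < y
  · exact exists_isMaxChain_of_jumps_accumulate φ hnb hbot hacc
  · push Not at hacc
    obtain ⟨ε, hε, hfree⟩ := hacc
    exact exists_isMaxChain_of_jumpFree_bot φ hε fun a ha hj => (hfree a hj).not_gt ha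

theorem theorem7 (n : ℕ) (hn : 1 ≤ n) :
    (∀ (L : Type*) [CompleteLinearOrder L] [TopologicalSpace L] [OrderTopology L],
      Nonempty (L ↪o ℝ) → (𝓝[≠] (⊥ : L)).NeBot →
        ∃ C : Set (copiesOrEmpty (cLT n)), IsMaxChain (· ≤ ·) C ∧ Nonempty (L ≃o C)) ∧
    ∃ e : copiesOrEmpty (fun p q : ℚ => p < q) ≃o copiesOrEmpty (cLT n),
      ∀ A, (e A : Set (ℚ × Fin n)) = (A : Set ℚ) ×ˢ (Set.univ : Set (Fin n)) := by
  obtain ⟨e, he⟩ := exists_orderIso_prod_univ hn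
  refine ⟨fun L _ _ _ ⟨φ⟩ hL => ?_, e, he⟩
  obtain ⟨C, hC, ⟨i⟩⟩ := exists_isMaxChain_copies_rat φ hL
  exact exists_isMaxChain_of_orderIso e hC i
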